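/- Let $\mathcal{X}$ be a nonempty measurable space, let $\mathcal{D}\subseteq\{0,1\}^{\mathcal{X}}$ be a (finite or infinite) class of measurable functions, and write $p(d)=\mathbb{E}_{x\sim p}[d(x)]$ and $\mathrm{IPM}_{\mathcal{D}}(p,q)=\sup_{d\in\mathcal{D}}|p(d)-q(d)|$ for probability measures $p,q$ on $\mathcal{X}$ (the supremum is $0$ if $\mathcal{D}=\emptyset$). The *dual Littlestone dimension* $\ell^*\in\mathbb{N}\cup\{\infty\}$ of $\mathcal{D}$ is the Littlestone dimension of the dual class $\{d\mapsto d(x) : x\in\mathcal{X}\}$ of functions on $\mathcal{D}$, that is, the supremum of the depths $n$ of complete binary trees with internal nodes labelled by elements of $\mathcal{D}$ such that for every root-to-leaf path, with labels $d_1,\dots,d_n$ and directions $y_1,\dots,y_n\in\{0,1\}$ (left is $0$, right is $1$), there is an $x\in\mathcal{X}$ with $d_i(x)=y_i$ for all $i\le n$. In the *sequential game* with error $\epsilon>0$ the discriminator knows a target probability measure $p_{\mathrm{real}}$ on $\mathcal{X}$. In round $t=1,2,\dots$ the generator, knowing only the earlier replies, submits a probability measure $p_t$. If $\mathrm{IPM}_{\mathcal{D}}(p_t,p_{\mathrm{real}})\le\epsilon$,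 the discriminator replies "WIN" and the game ends; otherwise it replies with some $d_t\in\mathcal{D}$ such that $|p_{\mathrm{real}}(d_t)-p_t(d_t)|>\epsilon$, together with a bit that tells whether $p_t(d_t)<p_{\mathrm{real}}(d_t)$ or $p_t(d_t)>p_{\mathrm{real}}(d_t)$. Both players are deterministic. The *round complexity* $T(\epsilon)\in\mathbb{N}\cup\{\infty\}$ is the least $T$ for which some generator wins against every discriminator and every target within at most $T$ rounds (the round of the reply "WIN" included), and $\infty$ if there is no such $T$. Then the following hold. 1. There is an absolute constant $C>0$ such that, whenever $\ell^*<\infty$, $T(\epsilon)$ is finite for every $\epsilon>0$ and $$T(\epsilon)\le C\,\frac{\ell^*}{\epsilon^2}\log\frac{\ell^*}{\epsilon}\qquad\text{if } \ell^*\ge 1 \text{ and } 0<\epsilon\le\tfrac12,$$ $$T(\epsilon)\le 1+C\,\frac{\ell^*}{\epsilon^2}\log\Bigl(2+\frac{\ell^*}{\epsilon}\Bigr)\qquad\text{for all } \ell^*\ge 0 \text{ and all } \epsilon>0.$$ 2. $T(\epsilon)\ge \ell^*/2$ for every $0<\epsilon<\tfrac12$; in particular $T(\epsilon)=\infty$ if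 $\ell^*=\infty$. -/

import Mathlib

open MeasureTheory

noncomputable section

namespace SequentialFooling

/-! ### Littlestone dimension and dual Littlestone dimension -/

/-- Complete binary mistake trees of depth `n`, with internal nodes labelled by elements of `W`.
The left child of a node corresponds to the label `false` (0), the right child to `true` (1). -/
inductive MistakeTree (W : Type*) : ℕ → Type _
  | leaf : MistakeTree W 0
  | node {n : ℕ} (w : W) (left right : MistakeTree W n) : MistakeTree W (n + 1)

/-- The root-to-leaf paths of a mistake tree, each one written as the sequence of examples
`(w₁, y₁), …, (wₙ, yₙ)` that it describes. -/
def MistakeTree.paths {W : Type*} : {n : ℕ} → MistakeTree W n → Set (List (W × Bool))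
  | _, .leaf => {[]}
  | _, .node w left right =>
      (fun s => (w, false) :: s) '' left.paths ∪ (fun s => (w, true) :: s) '' right.paths

/-- A mistake tree is shattered by `H` if every root-to-leaf path is realized by some `h ∈ H`. -/
def MistakeTree.Shattered {W : Type*} {n : ℕ} (t : MistakeTree W n) (H : Set (W → Bool)) : Prop :=
  ∀ s ∈ t.paths, ∃ h ∈ H, ∀ e ∈ s, h e.1 = e.2

/-- The Littlestone dimension of `H ⊆ {0,1}^W`: the maximal depth of a complete mistake tree
that is shattered by `H` (`⊤` if there are shattered complete trees of unbounded depth). -/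
def littlestoneDim {W : Type*} (H : Set (W → Bool)) : ℕ∞ :=
  ⨆ n ∈ {n : ℕ | ∃ t : MistakeTree W n, t.Shattered H}, (n : ℕ∞)

/-- The dual class of `D ⊆ {0,1}^X`: the functions `d ↦ d x` on `D`, for `x : X`. -/
def dualClass {X : Type*} (D : Set (X → Bool)) : Set (D → Bool) :=
  Set.range fun (x : X) (d : D) => d.1 x

/-- The dual Littlestone dimension of `D ⊆ {0,1}^X`. -/
def dualLittlestoneDim {X : Type*} (D : Set (X → Bool)) : ℕ∞ :=
  littlestoneDim (dualClass D)

/-! ### The sequential game -/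

section Game

variable {X : Type*} [MeasurableSpace X]

/-- `p(d) = E_{x ∼ p}[d(x)] = Pr_{x ∼ p}[d(x) = 1]`. -/
def prob (p : ProbabilityMeasure X) (d : X → Bool) : ℝ :=
  (p : Measure X).real {x | d x = true}

/-- The integral probability metric `IPM_D(p, q) = sup_{d ∈ D} |p(d) - q(d)|`. -/
def ipm (D : Set (X → Bool)) (p q : ProbabilityMeasure X) : ℝ :=
  ⨆ d : D, |prob p d.1 - prob q d.1|

/-- A reply other than `WIN`: a distinguisher together with a bit. -/
abbrev Reply (X : Type*) : Type _ := (X → Bool) × Bool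

/-- A (deterministic) generator: it submits a distribution depending on the list of replies
received so far (most recent first). -/
abbrev Generator (X : Type*) [MeasurableSpace X] : Type _ :=
  List (Reply X) → ProbabilityMeasure X

/-- A (deterministic) discriminator: it receives the target distribution, and replies to the list
of distributions submitted so far (most recent first). The reply `none` stands for `WIN`. -/
abbrev Discriminator (X : Type*) [MeasurableSpace X] : Type _ :=
  ProbabilityMeasure X → List (ProbabilityMeasure X) → Option (Reply X)

/-- The rule of the game for the discriminator. If the last submission `p` is within `ε` of the
target `q`, it replies `WIN`. Otherwise it replies with some `d ∈ D` such that
`|q(d) - p(d)| > ε` and the bit that tells whether `p(d) < q(d)` or `p(d) > q(d)`. -/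
def Discriminator.IsLegal (D : Set (X → Bool)) (ε : ℝ) (B : Discriminator X) : Prop :=
  ∀ (q p : ProbabilityMeasure X) (ps : List (ProbabilityMeasure X)),
    (ipm D p q ≤ ε → B q (p :: ps) = none) ∧
    (ε < ipm D p q → ∃ d ∈ D, ∃ b : Bool, B q (p :: ps) = some (d, b) ∧
      ε < |prob q d - prob p d| ∧ (b = true ↔ prob p d < prob q d))

/-- The state of the game between `G` and `B` with target `q` after `t` rounds: `none` if the
discriminator has replied `WIN` in one of these rounds, and otherwise the list of the `t` replies
(most recent first). When the list of replies is `h`, the list of all distributions submitted up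
to and including the next round is `h.tails.map G` (most recent first). -/
def play (G : Generator X) (B : Discriminator X) (q : ProbabilityMeasure X) :
    ℕ → Option (List (Reply X))
  | 0 => some []
  | t + 1 => (play G B q t).bind fun h => (B q (h.tails.map G)).map fun r => r :: h

/-- The class `D` can be `ε`-fooled in `T` rounds: some generator wins against every
discriminator and every target distribution within at most `T` rounds. The round in which the
discriminator replies `WIN` is counted. -/
def FooledWithin (D : Set (X → Bool)) (ε : ℝ) (T : ℕ) : Prop :=
  ∃ G : Generator X, ∀ B : Discriminator X, B.IsLegal D ε →
    ∀ q : ProbabilityMeasure X, play G B q T = none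

/-- The round complexity `T(ε)` of sequentially fooling `D`: the minimal number of rounds that
suffices to `ε`-fool `D`, and `⊤` if no finite number suffices. -/
def roundComplexity (D : Set (X → Bool)) (ε : ℝ) : ℕ∞ :=
  ⨅ T ∈ {T : ℕ | FooledWithin D ε T}, (T : ℕ∞)

end Game

end SequentialFooling

end

/-! Upper bound. Read the reply (d, b) as the function d or -d, with the sign given by the bit. In
each round without "WIN" the target's mean of this function exceeds the submission's by more than ε.
The target's total is at most the supremum over points x of the summed functions, so a generator
whose regret against the best point is less than Nε cannot survive N rounds.

Such a generator plays nearly optimally for `potential`, a sequential Rademacher complexity: the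
supremum over trees of moves of the expected supremum over x of a randomly signed sum.
Symmetrization (`sum_potential_le`) shows that a best response to a known mixture of moves pays for
one step of the potential. A minimax argument turns this into one mean that is good against all
moves. Hahn-Banach separation gives it for finitely many moves. The passage to infinitely many,
without compactness, is `exists_finiteMeans_forall_of_finset`: failure would create long half
graphs, which make the potential grow linearly (`le_potential_of_halfGraph`).

Sublinear growth comes from finite dual Littlestone dimension. Give a set of points the weight K ^
dimension; splitting it by a distinguisher multiplies the total weight by at most 1 + 1/K, since one
part drops in dimension (`littlestoneWeight_split`). Together with an exponential moment bound
(`exp_potential_le`) this gives potential ≤ nγ/2 + O(ℓ log K / γ) for K ≥ 32/γ².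

Lower bound. Walk down a shattered tree, always towards the answer to which the submission gives
probability at most 1/2. A Dirac target realizing the path keeps every distance at least 1/2 > ε. -/

noncomputable section

namespace SequentialFooling

/-! ### Sequential Rademacher potential, minimax, and growth bounds -/

section Potential

variable {X J : Type*}

/-- A relaxation of the value of the `n`-round online linear game in which the adversary plays
functions `u j` and the cumulative payoff of the comparator `x` is initially `L x`. -/
def potential (u : J → X → ℝ) : ℕ → (X → ℝ) → ℝ
  | 0, L => ⨆ x, L x
  | n + 1, L => ⨆ j, (potential u n (L + (2 : ℝ) • u j) + potential u n (L - (2 : ℝ) • u j)) / 2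

/-- Real suprema default to 0 on unbounded families, so boundedness above has to accompany every
cumulative payoff. -/
theorem bddAbove_range_of_le_add {L L' : X → ℝ} (hL : BddAbove (Set.range L)) {C : ℝ}
    (h : ∀ x, L' x ≤ L x + C) : BddAbove (Set.range L') := by
  obtain ⟨B, hB⟩ := hL
  refine ⟨B + C, ?_⟩
  rintro _ ⟨x, rfl⟩
  have := hB ⟨x, rfl⟩
  linarith [h x]

variable {u : J → X → ℝ}

theorem bddAbove_range_add_smul (hu : ∀ j x, |u j x| ≤ 1) {L : X → ℝ}
    (hL : BddAbove (Set.range L)) (a : ℝ) (j : J) : BddAbove (Set.range (L + a • u j)) := by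
  refine bddAbove_range_of_le_add hL (C := |a|) fun x => ?_
  simp only [Pi.add_apply, Pi.smul_apply, smul_eq_mul]
  have := le_abs_self (a * u j x)
  rw [abs_mul] at this
  nlinarith [hu j x, abs_nonneg a]

theorem bddAbove_range_sub_smul (hu : ∀ j x, |u j x| ≤ 1) {L : X → ℝ}
    (hL : BddAbove (Set.range L)) (a : ℝ) (j : J) : BddAbove (Set.range (L - a • u j)) := by
  have := bddAbove_range_add_smul hu hL (-a) j
  rwa [neg_smul, ← sub_eq_add_neg] at this

theorem potential_le [Nonempty X] [Nonempty J] (hu : ∀ j x, |u j x| ≤ 1) (n : ℕ) :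
    ∀ (L : X → ℝ) (B : ℝ), (∀ x, L x ≤ B) → potential u n L ≤ B + 2 * n := by
  induction n with
  | zero => intro L B h; simpa [potential] using ciSup_le h
  | succ n ih =>
    intro L B h
    refine ciSup_le fun j => ?_
    have h1 := ih (L + (2 : ℝ) • u j) (B + 2) fun x => by
      simp only [Pi.add_apply, Pi.smul_apply, smul_eq_mul]
      linarith [h x, (abs_le.1 (hu j x)).2]
    have h2 := ih (L - (2 : ℝ) • u j) (B + 2) fun x => by
      simp only [Pi.sub_apply, Pi.smul_apply, smul_eq_mul]
      linarith [h x, (abs_le.1 (hu j x)).1]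
    push_cast
    linarith

theorem bddAbove_range_potential_step [Nonempty X] [Nonempty J] (hu : ∀ j x, |u j x| ≤ 1) (n : ℕ)
    {L : X → ℝ} (hL : BddAbove (Set.range L)) :
    BddAbove (Set.range fun j =>
      (potential u n (L + (2 : ℝ) • u j) + potential u n (L - (2 : ℝ) • u j)) / 2) := by
  obtain ⟨B, hB⟩ := hL
  refine ⟨B + 2 + 2 * n, ?_⟩
  rintro _ ⟨j, rfl⟩
  have h1 := potential_le hu n (L + (2 : ℝ) • u j) (B + 2) fun x => by
    simp only [Pi.add_apply, Pi.smul_apply, smul_eq_mul]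
    linarith [hB ⟨x, rfl⟩, (abs_le.1 (hu j x)).2]
  have h2 := potential_le hu n (L - (2 : ℝ) • u j) (B + 2) fun x => by
    simp only [Pi.sub_apply, Pi.smul_apply, smul_eq_mul]
    linarith [hB ⟨x, rfl⟩, (abs_le.1 (hu j x)).1]
  dsimp only
  linarith

theorem le_potential_succ [Nonempty X] [Nonempty J] (hu : ∀ j x, |u j x| ≤ 1) (n : ℕ)
    {L : X → ℝ} (hL : BddAbove (Set.range L)) (j : J) :
    (potential u n (L + (2 : ℝ) • u j) + potential u n (L - (2 : ℝ) • u j)) / 2 ≤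
      potential u (n + 1) L :=
  le_ciSup (bddAbove_range_potential_step hu n hL) j

theorem potential_le_add_of_le_add [Nonempty X] [Nonempty J] (hu : ∀ j x, |u j x| ≤ 1) (n : ℕ) :
    ∀ (L L' : X → ℝ) (c : ℝ), BddAbove (Set.range L') → (∀ x, L x ≤ L' x + c) →
      potential u n L ≤ potential u n L' + c := by
  induction n with
  | zero =>
    intro L L' c hL' h
    exact ciSup_le fun x => (h x).trans (add_le_add_left (le_ciSup hL' x) c)
  | succ n ih =>
    intro L L' c hL' h
    refine ciSup_le fun j => ?_
    have h1 := ih (L + (2 : ℝ) • u j) (L' + (2 : ℝ) • u j) c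
      (bddAbove_range_add_smul hu hL' 2 j) fun x => by
        simp only [Pi.add_apply]; linarith [h x]
    have h2 := ih (L - (2 : ℝ) • u j) (L' - (2 : ℝ) • u j) c
      (bddAbove_range_sub_smul hu hL' 2 j) fun x => by
        simp only [Pi.sub_apply]; linarith [h x]
    linarith [le_potential_succ hu n hL' j]

theorem convex_setOf_bddAbove_range : Convex ℝ {L : X → ℝ | BddAbove (Set.range L)} := by
  rintro L ⟨B, hB⟩ L' ⟨B', hB'⟩ a b ha hb _
  refine ⟨a * B + b * B', ?_⟩
  rintro _ ⟨x, rfl⟩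
  simp only [Pi.add_apply, Pi.smul_apply, smul_eq_mul]
  exact add_le_add (mul_le_mul_of_nonneg_left (hB ⟨x, rfl⟩) ha)
    (mul_le_mul_of_nonneg_left (hB' ⟨x, rfl⟩) hb)

/-- Translations, averages and suprema all preserve convexity. -/
theorem convexOn_potential [Nonempty X] [Nonempty J] (hu : ∀ j x, |u j x| ≤ 1) (n : ℕ) :
    ConvexOn ℝ {L : X → ℝ | BddAbove (Set.range L)} (potential u n) := by
  induction n with
  | zero =>
    refine ⟨convex_setOf_bddAbove_range, fun L hL L' hL' a b ha hb _ => ciSup_le fun x => ?_⟩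
    simp only [Pi.add_apply, Pi.smul_apply, smul_eq_mul]
    exact add_le_add (mul_le_mul_of_nonneg_left (le_ciSup hL x) ha)
      (mul_le_mul_of_nonneg_left (le_ciSup hL' x) hb)
  | succ n ih =>
    refine ⟨convex_setOf_bddAbove_range, fun L hL L' hL' a b ha hb hab => ciSup_le fun j => ?_⟩
    have e : (2 : ℝ) • u j = a • (2 : ℝ) • u j + b • (2 : ℝ) • u j := by
      rw [← add_smul, hab, one_smul]
    have e1 : a • L + b • L' + (2 : ℝ) • u j =
        a • (L + (2 : ℝ) • u j) + b • (L' + (2 : ℝ) • u j) := by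
      nth_rewrite 1 [e]; simp only [smul_add]; abel
    have e2 : a • L + b • L' - (2 : ℝ) • u j =
        a • (L - (2 : ℝ) • u j) + b • (L' - (2 : ℝ) • u j) := by
      nth_rewrite 1 [e]; simp only [smul_sub]; abel
    have h1 := ih.2 (bddAbove_range_add_smul hu hL 2 j) (bddAbove_range_add_smul hu hL' 2 j)
      ha hb hab
    have h2 := ih.2 (bddAbove_range_sub_smul hu hL 2 j) (bddAbove_range_sub_smul hu hL' 2 j)
      ha hb hab
    rw [e1, e2]
    have h3 := mul_le_mul_of_nonneg_left (le_potential_succ hu n hL j) ha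
    have h4 := mul_le_mul_of_nonneg_left (le_potential_succ hu n hL' j) hb
    simp only [smul_eq_mul] at h1 h2 ⊢
    linarith

/-- The symmetrization step: against a known mixture of adversarial moves, a best response of the
player does not increase the potential. -/
theorem sum_potential_le [Nonempty X] [Nonempty J] (hu : ∀ j x, |u j x| ≤ 1) (n : ℕ)
    {L : X → ℝ} (hL : BddAbove (Set.range L)) (F : Finset J) (w : J → ℝ)
    (hw : ∀ j ∈ F, 0 ≤ w j) (hw1 : ∑ j ∈ F, w j = 1) :
    ∑ j ∈ F, w j * potential u n (L + u j) ≤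
      potential u (n + 1) L + ⨆ x, ∑ j ∈ F, w j * u j x := by
  set m : X → ℝ := fun x => ∑ j ∈ F, w j * u j x with hm
  have habs : ∀ x, |m x| ≤ 1 := fun x => by
    refine (Finset.abs_sum_le_sum_abs _ _).trans ?_
    rw [← hw1]
    refine Finset.sum_le_sum fun j hj => ?_
    rw [abs_mul, abs_of_nonneg (hw j hj)]
    exact mul_le_of_le_one_right (hw j hj) (hu j x)
  have hmb : BddAbove (Set.range m) := by
    refine ⟨1, ?_⟩
    rintro _ ⟨x, rfl⟩
    exact (abs_le.1 (habs x)).2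
  have hLm : BddAbove (Set.range (L - (2 : ℝ) • m)) :=
    bddAbove_range_of_le_add hL (C := 2) fun x => by
      simp only [Pi.sub_apply, Pi.smul_apply, smul_eq_mul]
      linarith [(abs_le.1 (habs x)).1]
  have hjensen : potential u n (L - (2 : ℝ) • m) ≤
      ∑ j ∈ F, w j * potential u n (L - (2 : ℝ) • u j) := by
    have := (convexOn_potential hu n).map_sum_le hw hw1
      (fun j _ => bddAbove_range_sub_smul hu hL 2 j)
    have hlin : ∑ j ∈ F, w j • (L - (2 : ℝ) • u j) = L - (2 : ℝ) • m := by
      ext x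
      simp only [Pi.sub_apply, Pi.smul_apply, smul_eq_mul, Finset.sum_apply, mul_sub,
        Finset.sum_sub_distrib, ← Finset.sum_mul, hw1, hm, one_mul]
      rw [Finset.mul_sum]
      congr 1
      exact Finset.sum_congr rfl fun j _ => by ring
    rwa [hlin] at this
  -- Symmetrization: `L + u j` is the midpoint of `L + 2 u j` and `L - 2 m`, plus `m`, and `m` is at
  -- most its supremum. Jensen then replaces the mean `m` by an independent copy of the move.
  have hj : ∀ j, potential u n (L + u j) ≤ potential u n (L + (2 : ℝ) • u j) / 2 +
      potential u n (L - (2 : ℝ) • m) / 2 + ⨆ x, m x := fun j => by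
    have h2 := (convexOn_potential hu n).2 (bddAbove_range_add_smul hu hL 2 j) hLm
      (by norm_num : (0 : ℝ) ≤ 1 / 2) (by norm_num : (0 : ℝ) ≤ 1 / 2) (by norm_num)
    have h1 := potential_le_add_of_le_add hu n (L + u j)
      ((1 / 2 : ℝ) • (L + (2 : ℝ) • u j) + (1 / 2 : ℝ) • (L - (2 : ℝ) • m)) (⨆ x, m x)
      (convex_setOf_bddAbove_range (bddAbove_range_add_smul hu hL 2 j) hLm
        (by norm_num) (by norm_num) (by norm_num))
      (fun x => by
        simp only [Pi.add_apply, Pi.sub_apply, Pi.smul_apply, smul_eq_mul]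
        linarith [le_ciSup hmb x])
    simp only [smul_eq_mul] at h2
    linarith
  have hs : ∑ j ∈ F, w j * potential u n (L + u j) ≤
      ∑ j ∈ F, (w j * potential u n (L + (2 : ℝ) • u j) / 2 +
        w j * (potential u n (L - (2 : ℝ) • m) / 2 + ⨆ x, m x)) :=
    Finset.sum_le_sum fun j hjF => by nlinarith [mul_le_mul_of_nonneg_left (hj j) (hw j hjF)]
  rw [Finset.sum_add_distrib, ← Finset.sum_mul, hw1, one_mul] at hs
  have ht : ∑ j ∈ F, w j * ((potential u n (L + (2 : ℝ) • u j) +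
      potential u n (L - (2 : ℝ) • u j)) / 2) ≤ potential u (n + 1) L := by
    calc _ ≤ ∑ j ∈ F, w j * potential u (n + 1) L := Finset.sum_le_sum fun j hjF =>
          mul_le_mul_of_nonneg_left (le_potential_succ hu n hL j) (hw j hjF)
      _ = _ := by rw [← Finset.sum_mul, hw1, one_mul]
  have he : ∑ j ∈ F, w j * ((potential u n (L + (2 : ℝ) • u j) +
      potential u n (L - (2 : ℝ) • u j)) / 2) =
      ∑ j ∈ F, w j * potential u n (L + (2 : ℝ) • u j) / 2 +
        (∑ j ∈ F, w j * potential u n (L - (2 : ℝ) • u j)) / 2 := by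
    rw [Finset.sum_div, ← Finset.sum_add_distrib]
    exact Finset.sum_congr rfl fun j _ => by ring
  linarith

/-- The finitely supported means on `X`, as linear functionals on functions. -/
def finiteMeans (X : Type*) : Set ((X → ℝ) →ₗ[ℝ] ℝ) :=
  convexHull ℝ (Set.range fun x => (LinearMap.proj x : (X → ℝ) →ₗ[ℝ] ℝ))

theorem convex_finiteMeans : Convex ℝ (finiteMeans X) := convex_convexHull _ _

theorem proj_mem_finiteMeans (x : X) : (LinearMap.proj x : (X → ℝ) →ₗ[ℝ] ℝ) ∈ finiteMeans X :=
  subset_convexHull _ _ ⟨x, rfl⟩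

theorem finiteMeans_le {φ : (X → ℝ) →ₗ[ℝ] ℝ} (hφ : φ ∈ finiteMeans X) {L : X → ℝ} {B : ℝ}
    (h : ∀ x, L x ≤ B) : φ L ≤ B := by
  refine convexHull_min (t := {φ : (X → ℝ) →ₗ[ℝ] ℝ | φ L ≤ B}) ?_ ?_ hφ
  · rintro _ ⟨x, rfl⟩
    exact h x
  · intro φ h1 ψ h2 a b ha hb hab
    simp only [Set.mem_ofPred_eq, LinearMap.add_apply, LinearMap.smul_apply, smul_eq_mul] at *
    calc a * φ L + b * ψ L ≤ a * B + b * B := by gcongr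
      _ = B := by rw [← add_mul, hab, one_mul]

theorem abs_finiteMeans_le {φ : (X → ℝ) →ₗ[ℝ] ℝ} (hφ : φ ∈ finiteMeans X) {L : X → ℝ} {B : ℝ}
    (h : ∀ x, |L x| ≤ B) : |φ L| ≤ B := by
  rw [abs_le]
  constructor
  · have := finiteMeans_le hφ (L := -L) (B := B) fun x => by
      simpa using neg_le.1 (abs_le.1 (h x)).1
    rw [map_neg] at this
    linarith
  · exact finiteMeans_le hφ fun x => (abs_le.1 (h x)).2

/-- A minimax theorem for finitely many moves of the adversary. -/
theorem exists_finiteMeans_forall_finset [Nonempty X] (F : Finset J) (c : J → ℝ) (v : ℝ)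
    (h : ∀ w : J → ℝ, (∀ j ∈ F, 0 ≤ w j) → ∑ j ∈ F, w j = 1 →
      ∑ j ∈ F, w j * c j ≤ v + ⨆ x, ∑ j ∈ F, w j * u j x) {δ : ℝ} (hδ : 0 < δ) :
    ∃ φ ∈ finiteMeans X, ∀ j ∈ F, c j - φ (u j) ≤ v + δ := by
  classical
  -- `A` is the convex set of attainable excess vectors and `B` below is the open orthant of
  -- acceptable ones. If they are disjoint, a separating functional yields a mixture of moves that
  -- contradicts `h`.
  set A : Set (F → ℝ) := (fun φ : (X → ℝ) →ₗ[ℝ] ℝ => fun j : F => c j - φ (u j)) '' finiteMeans X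
  have hA : Convex ℝ A := by
    rintro _ ⟨φ, hφ, rfl⟩ _ ⟨ψ, hψ, rfl⟩ a b ha hb hab
    refine ⟨_, convex_finiteMeans hφ hψ ha hb hab, ?_⟩
    ext j
    simp only [LinearMap.add_apply, LinearMap.smul_apply, smul_eq_mul, Pi.add_apply,
      Pi.smul_apply]
    linear_combination (-(c j)) * hab
  set B : Set (F → ℝ) := Set.univ.pi fun _ => Set.Iio (v + δ)
  have hB : Convex ℝ B := convex_pi fun _ _ => convex_Iio _
  have hBo : IsOpen B := isOpen_set_pi Set.finite_univ fun _ _ => isOpen_Iio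
  by_contra! hne
  have hdisj : Disjoint B A := by
    rw [Set.disjoint_left]
    rintro _ hb ⟨φ, hφ, rfl⟩
    obtain ⟨j, hj, hlt⟩ := hne φ hφ
    exact absurd (hb ⟨j, hj⟩ trivial) (by simpa using hlt.le)
  obtain ⟨g, t, hgB, hgA⟩ := geometric_hahn_banach_open hB hBo hA hdisj
  set e : F → ℝ := fun j => g (Pi.single j 1) with he
  have hg : ∀ z : F → ℝ, g z = ∑ j, z j * e j := fun z => by
    conv_lhs => rw [pi_eq_sum_univ' z]
    simp [he, map_sum]
  -- `B` is closed under decreasing a coordinate and `g` is bounded above on it, so no coefficient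
  -- is negative.
  have henn : ∀ j, 0 ≤ e j := fun j => by
    by_contra! hneg
    have hb : ∀ M : ℝ, 0 ≤ M → g (fun _ : F => v + δ / 2) - M * e j < t := fun M hM => by
      have hmemB : (fun _ : F => v + δ / 2) - M • Pi.single j (1 : ℝ) ∈ B := fun i _ => by
        simp only [Pi.sub_apply, Pi.smul_apply, smul_eq_mul, Set.mem_Iio]
        have : (0 : ℝ) ≤ (Pi.single j (1 : ℝ) : F → ℝ) i := by
          by_cases hij : i = j
          · subst hij; simp
          · simp [hij]
        nlinarith
      have := hgB _ hmemB
      rwa [map_sub, map_smul, smul_eq_mul] at this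
    have h0 := hb 0 le_rfl
    have := hb ((t - g fun _ : F => v + δ / 2) / (-e j))
      (div_nonneg (by linarith) (by linarith))
    rw [div_mul_eq_mul_div, mul_div_assoc, div_neg, div_self hneg.ne] at this
    linarith
  have hmid : ∀ x, (v + δ / 2) * ∑ j, e j < ∑ j : F, (c j - u j x) * e j := fun x => by
    have h1 : g (fun _ : F => v + δ / 2) < t := hgB _ fun j _ => by simpa using hδ
    have h2 := hgA _ ⟨_, proj_mem_finiteMeans x, rfl⟩
    rw [hg] at h1 h2
    simp only [LinearMap.proj_apply] at h2
    rw [Finset.mul_sum]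
    exact h1.trans_le h2
  have hpos : 0 < ∑ j, e j := by
    refine (Finset.sum_nonneg fun j _ => henn j).lt_of_ne fun h0 => ?_
    have hz : ∀ j, e j = 0 := fun j =>
      (Finset.sum_eq_zero_iff_of_nonneg fun j _ => henn j).1 h0.symm j (Finset.mem_univ j)
    have := hmid (Classical.arbitrary X)
    simp [hz] at this
  set s := ∑ j, e j with hs
  set w : J → ℝ := fun j => if hj : j ∈ F then e ⟨j, hj⟩ / s else 0 with hwdef
  have hsum : ∀ z : J → ℝ, ∑ j ∈ F, w j * z j = (∑ j : F, z j * e j) / s := fun z => by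
    rw [← Finset.sum_attach, Finset.univ_eq_attach, Finset.sum_div]
    refine Finset.sum_congr rfl fun j _ => ?_
    simp only [hwdef, j.2, dif_pos]
    ring
  have hw1 : ∑ j ∈ F, w j = 1 := by
    have := hsum fun _ => 1
    simp only [mul_one, one_mul] at this
    rw [this]
    exact div_self hpos.ne'
  have hle := h w (fun j hj => by
    simp only [hwdef, hj, dif_pos]; exact div_nonneg (henn _) hpos.le) hw1
  have hsup : (⨆ x, ∑ j ∈ F, w j * u j x) ≤ ∑ j ∈ F, w j * c j - (v + δ / 2) := by
    refine ciSup_le fun x => ?_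
    rw [hsum c, hsum fun j => u j x]
    have := hmid x
    simp only [sub_mul, Finset.sum_sub_distrib] at this
    rw [le_sub_comm, ← sub_div, le_div_iff₀ hpos]
    exact this.le
  linarith

/-- A half graph of size `2 ^ n` with gap `γ` between means and moves forces the potential to be
at least `n * γ`. -/
theorem le_potential_of_halfGraph [Nonempty X] [Nonempty J] (hu : ∀ j x, |u j x| ≤ 1)
    {φ : ℕ → (X → ℝ) →ₗ[ℝ] ℝ} (hφ : ∀ l, φ l ∈ finiteMeans X) {e : ℕ → J} {r : ℕ → ℝ} {γ : ℝ}
    {N : ℕ} (hle : ∀ k < N, ∀ l ≤ k, φ l (u (e k)) ≤ r k - γ)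
    (hlt : ∀ l < N, ∀ k < l, r k ≤ φ l (u (e k))) (n : ℕ) :
    ∀ (a : ℕ) (L : X → ℝ) (m : ℝ), BddAbove (Set.range L) → a + 2 ^ n ≤ N →
      (∀ l, a ≤ l → l < a + 2 ^ n → m ≤ φ l L) → m + n * γ ≤ potential u n L := by
  induction n with
  | zero =>
    intro a L m hL _ hm
    have h1 := hm a le_rfl (by simp)
    have h2 := finiteMeans_le (hφ a) (le_ciSup hL)
    simpa [potential] using h1.trans h2
  | succ n ih =>
    intro a L m hL ha hm
    have hp : 0 < 2 ^ n := by positivity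
    rw [pow_succ] at ha hm
    -- Binary search: `k` is the last index of the left half. Indices up to `k` follow the minus
    -- branch and later ones the plus branch; the average of the two branches gains exactly `γ`.
    set k := a + 2 ^ n - 1 with hk
    have h1 := ih a (L - (2 : ℝ) • u (e k)) (m - 2 * (r k - γ))
      (bddAbove_range_sub_smul hu hL 2 _) (by omega) fun l h1 h2 => by
        rw [map_sub, map_smul, smul_eq_mul]
        linarith [hm l h1 (by omega), hle k (by omega) l (by omega)]
    have h2 := ih (a + 2 ^ n) (L + (2 : ℝ) • u (e k)) (m + 2 * r k)
      (bddAbove_range_add_smul hu hL 2 _) (by omega) fun l h1 h2 => by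
        rw [map_add, map_smul, smul_eq_mul]
        linarith [hm l (by omega) (by omega), hlt l (by omega) k (by omega)]
    have h3 := le_potential_succ hu n hL (e k)
    push_cast
    linarith

/-- If the constraints `c j - φ (u j) ≤ v` are satisfiable by finite means on finite sets of moves
and the potential grows sublinearly, then they are approximately satisfiable simultaneously. -/
theorem exists_finiteMeans_forall_of_finset [Nonempty X] [Nonempty J] (hu : ∀ j x, |u j x| ≤ 1)
    (hgrow : ∀ γ : ℝ, 0 < γ → ∃ n : ℕ, potential u n 0 < n * γ) (c : J → ℝ) (v : ℝ)
    (h : ∀ F : Finset J, ∃ φ ∈ finiteMeans X, ∀ j ∈ F, c j - φ (u j) ≤ v) {δ : ℝ} (hδ : 0 < δ) :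
    ∃ φ ∈ finiteMeans X, ∀ j, c j - φ (u j) ≤ v + δ := by
  classical
  obtain ⟨n, hn⟩ := hgrow (δ / 2) (by linarith)
  set bad : ((X → ℝ) →ₗ[ℝ] ℝ) → J → Prop := fun φ j => v + δ / 2 < c j - φ (u j) with hbad
  -- One witness per finite set of means: a move bad for all of them, whenever there is one. There
  -- are only finitely many witnesses for the subsets of a finite set, so the next mean can satisfy
  -- all their constraints.
  obtain ⟨rep, hrep⟩ : ∃ rep : Finset ((X → ℝ) →ₗ[ℝ] ℝ) → J,
      ∀ s j, (∀ φ ∈ s, bad φ j) → ∀ φ ∈ s, bad φ (rep s) := by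
    have : ∀ s : Finset ((X → ℝ) →ₗ[ℝ] ℝ), ∃ i, ∀ j, (∀ φ ∈ s, bad φ j) → ∀ φ ∈ s, bad φ i := by
      intro s
      by_cases hs : ∃ i, ∀ φ ∈ s, bad φ i
      · exact ⟨hs.choose, fun _ _ => hs.choose_spec⟩
      · exact ⟨Classical.arbitrary J, fun j hj => absurd ⟨j, hj⟩ hs⟩
    choose rep hrep using this
    exact ⟨rep, hrep⟩
  choose next hnext hgood using fun s : Finset ((X → ℝ) →ₗ[ℝ] ℝ) => h (s.powerset.image rep)
  set S : ℕ → Finset ((X → ℝ) →ₗ[ℝ] ℝ) := fun k => Nat.rec ∅ (fun _ s => insert (next s) s) k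
    with hS
  have hSs : ∀ k, S (k + 1) = insert (next (S k)) (S k) := fun k => rfl
  set φ : ℕ → (X → ℝ) →ₗ[ℝ] ℝ := fun k => next (S k) with hφdef
  have hφ : ∀ l, φ l ∈ finiteMeans X := fun l => hnext _
  have hmem : ∀ l k, k < l → φ k ∈ S l := fun l => by
    induction l with
    | zero => intro k hk; omega
    | succ l ih =>
      intro k hk
      rw [hSs, Finset.mem_insert]
      rcases (Nat.lt_succ_iff_lt_or_eq.1 hk) with h1 | h1
      · exact Or.inr (ih k h1)
      · exact Or.inl (by rw [h1])
  -- A move bad for many means produces a half graph: the witness for an initial segment of those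
  -- means is bad for the segment and good for all later ones. Hence each move is bad for fewer than
  -- `2 ^ n` means, however long the sequence.
  have hcard : ∀ (W : Finset ℕ) (j : J), (∀ i ∈ W, bad (φ i) j) → W.card < 2 ^ n := by
    intro W j hW
    by_contra! hc
    set i : ℕ → ℕ := fun k => if hk : k < W.card then W.orderEmbOfFin rfl ⟨k, hk⟩ else 0 with hi
    have hiW : ∀ k < W.card, i k ∈ W := fun k hk => by
      simp only [hi, hk, dif_pos]; exact Finset.orderEmbOfFin_mem _ _ _
    have himono : ∀ k l, k < l → l < W.card → i k < i l := fun k l hkl hl => by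
      simp only [hi, hl, hkl.trans hl, dif_pos]
      exact (W.orderEmbOfFin rfl).strictMono hkl
    set w : ℕ → Finset ((X → ℝ) →ₗ[ℝ] ℝ) := fun k =>
      (Finset.range (k + 1)).image fun l => φ (i l) with hw
    have hwbad : ∀ k < W.card, ∀ l ≤ k, bad (φ (i l)) (rep (w k)) := fun k hk l hl => by
      refine hrep (w k) j ?_ _ (Finset.mem_image_of_mem _ (Finset.mem_range.2 (by omega)))
      intro ψ hψ
      obtain ⟨l', hl', rfl⟩ := Finset.mem_image.1 hψ
      exact hW _ (hiW l' (by have := Finset.mem_range.1 hl'; omega))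
    have hwgood : ∀ l < W.card, ∀ k < l,
        c (rep (w k)) - φ (i l) (u (rep (w k))) ≤ v := fun l hl k hk => by
      refine hgood (S (i l)) _ (Finset.mem_image_of_mem _ (Finset.mem_powerset.2 ?_))
      intro ψ hψ
      obtain ⟨l', hl', rfl⟩ := Finset.mem_image.1 hψ
      exact hmem _ _ (himono _ _ (by have := Finset.mem_range.1 hl'; omega) hl)
    have := le_potential_of_halfGraph hu (φ := fun l => φ (i l)) (fun l => hφ _)
      (e := fun k => rep (w k)) (r := fun k => c (rep (w k)) - v) (γ := δ / 2) (N := W.card)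
      (fun k hk l hl => by have := hwbad k hk l hl; simp only [hbad] at this; linarith)
      (fun l hl k hk => by have := hwgood l hl k hk; linarith)
      n 0 0 0 ⟨0, by rintro _ ⟨x, rfl⟩; simp⟩ (by omega) (fun l _ _ => by simp)
    linarith
  -- Averaging `N` means dilutes the bad ones: each adds at most 2, as `c j ≤ v + 1` by the
  -- hypothesis for `{j}`, so their total is at most `2 ^ n * 2 < N * (δ / 2)`.
  obtain ⟨N, hN⟩ := exists_nat_gt ((2 : ℝ) ^ n * 2 / (δ / 2))
  have hN0 : (0 : ℝ) < N := lt_of_le_of_lt (by positivity) hN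
  rw [div_lt_iff₀ (by linarith)] at hN
  refine ⟨∑ i ∈ Finset.range N, (1 / (N : ℝ)) • φ i, ?_, fun j => ?_⟩
  · refine convex_finiteMeans.sum_mem (fun _ _ => by positivity) ?_ fun i _ => hφ i
    simp [hN0.ne']
  · have hup : ∀ i, c j - φ i (u j) ≤ v + δ / 2 + if bad (φ i) j then 2 else 0 := fun i => by
      obtain ⟨ψ, hψ, hψj⟩ := h {j}
      have h1 := hψj j (by simp)
      have h2 := abs_le.1 (abs_finiteMeans_le hψ (hu j))
      have h3 := abs_le.1 (abs_finiteMeans_le (hφ i) (hu j))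
      split_ifs with hb
      · linarith
      · simp only [hbad, not_lt] at hb; linarith
    have hsum : ∑ i ∈ Finset.range N, (c j - φ i (u j)) ≤ N * (v + δ / 2) + 2 ^ n * 2 := by
      refine (Finset.sum_le_sum fun i _ => hup i).trans ?_
      rw [Finset.sum_add_distrib, ← Finset.sum_filter]
      simp only [Finset.sum_const, Finset.card_range, nsmul_eq_mul]
      have := hcard ((Finset.range N).filter fun i => bad (φ i) j) j
        (fun i hi => (Finset.mem_filter.1 hi).2)
      have : ((((Finset.range N).filter fun i => bad (φ i) j).card : ℕ) : ℝ) ≤ 2 ^ n := by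
        exact_mod_cast this.le
      linarith
    rw [Finset.sum_sub_distrib, Finset.sum_const, Finset.card_range, nsmul_eq_mul] at hsum
    rw [LinearMap.sum_apply]
    simp only [LinearMap.smul_apply, smul_eq_mul]
    rw [← Finset.mul_sum]
    refine le_of_mul_le_mul_left ?_ hN0
    rw [mul_sub, ← mul_assoc, mul_one_div_cancel hN0.ne', one_mul]
    linarith

/-- The player has a move that is nearly optimal for the relaxation. -/
theorem exists_finiteMeans_potential_le [Nonempty X] [Nonempty J] (hu : ∀ j x, |u j x| ≤ 1)
    (hgrow : ∀ γ : ℝ, 0 < γ → ∃ n : ℕ, potential u n 0 < n * γ) (n : ℕ)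
    {L : X → ℝ} (hL : BddAbove (Set.range L)) {δ : ℝ} (hδ : 0 < δ) :
    ∃ φ ∈ finiteMeans X, ∀ j,
      potential u n (L + u j) - φ (u j) ≤ potential u (n + 1) L + δ := by
  obtain ⟨φ, hφ, h⟩ := exists_finiteMeans_forall_of_finset hu hgrow
    (fun j => potential u n (L + u j)) (potential u (n + 1) L + δ / 2)
    (fun F => exists_finiteMeans_forall_finset F _ _
      (fun w hw hw1 => sum_potential_le hu n hL F w hw hw1) (half_pos hδ)) (half_pos hδ)
  exact ⟨φ, hφ, fun j => (h j).trans_eq (by ring)⟩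

/-- A bound on the potential from a weight on sets of comparators that nearly decreases under
splitting by a binary function. -/
theorem exp_potential_le [Nonempty X] [Nonempty J] {wt : Set X → ℝ} {ρ η : ℝ} (hρ : 0 ≤ ρ)
    (hη : 0 < η) (hwt : ∀ V, 0 ≤ wt V) (hwt1 : ∀ V, V.Nonempty → 1 ≤ wt V)
    {A : J → Set X} {s : J → ℝ} (hs : ∀ j, |s j| = 1)
    (hu : ∀ j x, u j x = s j * (A j).indicator 1 x)
    (hsplit : ∀ V j, wt (V ∩ A j) + wt (V \ A j) ≤ ρ * wt V) (n : ℕ) :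
    ∀ {ι : Type} [Fintype ι] (V : ι → Set X) (a : ι → ℝ) (L : X → ℝ),
      (∀ x, ∃ i, x ∈ V i) → (∀ i, ∀ x ∈ V i, L x ≤ a i) →
      Real.exp (η * potential u n L) ≤
        (Real.cosh (2 * η) * ρ) ^ n * ∑ i, Real.exp (η * a i) * wt (V i) := by
  have hC : 0 ≤ Real.cosh (2 * η) * ρ := mul_nonneg (Real.cosh_pos _).le hρ
  -- Taking logarithms lets the supremum in `potential` be bounded term by term.
  have key : ∀ (P Z : ℝ), 0 < Z → P ≤ Real.log Z / η → Real.exp (η * P) ≤ Z := by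
    intro P Z hZ hP
    rw [← Real.le_log_iff_exp_le hZ]
    rwa [le_div_iff₀' hη] at hP
  induction n with
  | zero =>
    intro ι _ V a L hV hL
    have hx : ∀ x, Real.exp (η * L x) ≤ ∑ i, Real.exp (η * a i) * wt (V i) := fun x => by
      obtain ⟨i, hi⟩ := hV x
      refine le_trans ?_ (Finset.single_le_sum
        (fun i _ => mul_nonneg (Real.exp_pos _).le (hwt _)) (Finset.mem_univ i))
      calc Real.exp (η * L x) ≤ Real.exp (η * a i) * 1 := by
            rw [mul_one]; gcongr; exact hL i x hi
        _ ≤ _ := by gcongr; exact hwt1 _ ⟨x, hi⟩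
    have hZ := (Real.exp_pos _).trans_le (hx (Classical.arbitrary X))
    rw [pow_zero, one_mul]
    refine key _ _ hZ (ciSup_le fun x => ?_)
    rw [le_div_iff₀' hη, Real.le_log_iff_exp_le hZ]
    exact hx x
  | succ n ih =>
    intro ι _ V a L hV hL
    set Z := (Real.cosh (2 * η) * ρ) ^ (n + 1) * ∑ i, Real.exp (η * a i) * wt (V i) with hZdef
    have hj : ∀ j, Real.exp (η * ((potential u n (L + (2 : ℝ) • u j) +
        potential u n (L - (2 : ℝ) • u j)) / 2)) ≤ Z := fun j => by
      -- Each cell is cut by `A j`. The payoff bound shifts only inside `A j`; outside, the factor 1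
      -- is enlarged to the hyperbolic cosine so that `hsplit` applies to both parts.
      set V' : ι × Bool → Set X := fun p => if p.2 then V p.1 ∩ A j else V p.1 \ A j with hV'
      have hcov : ∀ x, ∃ p, x ∈ V' p := fun x => by
        obtain ⟨i, hi⟩ := hV x
        by_cases hx : x ∈ A j
        · exact ⟨(i, true), by simp [hV', hi, hx]⟩
        · exact ⟨(i, false), by simp [hV', hi, hx]⟩
      have h1 := ih V' (fun p => if p.2 then a p.1 + 2 * s j else a p.1) (L + (2 : ℝ) • u j) hcov
        (by
          rintro ⟨i, b⟩ x hx
          cases b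
          · simp only [hV', Bool.false_eq_true, if_false] at hx ⊢
            simpa [hu, hx.2] using hL i x hx.1
          · simp only [hV', if_true] at hx ⊢
            simpa [hu, hx.2] using hL i x hx.1)
      have h2 := ih V' (fun p => if p.2 then a p.1 - 2 * s j else a p.1) (L - (2 : ℝ) • u j) hcov
        (by
          rintro ⟨i, b⟩ x hx
          cases b
          · simp only [hV', Bool.false_eq_true, if_false] at hx ⊢
            simpa [hu, hx.2] using hL i x hx.1
          · simp only [hV', if_true] at hx ⊢
            simpa [hu, hx.2] using hL i x hx.1)
      simp only [Fintype.sum_prod_type, Fintype.sum_bool, hV', if_true, Bool.false_eq_true,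
        if_false] at h1 h2
      have hcosh : Real.cosh (2 * η) =
          (Real.exp (η * (2 * s j)) + Real.exp (-(η * (2 * s j)))) / 2 := by
        rw [← Real.cosh_eq]
        rcases eq_or_eq_neg_of_abs_eq (hs j) with h | h <;> rw [h]
        · congr 1; ring
        · rw [← Real.cosh_neg]; congr 1; ring
      have hsum : (∑ i, (Real.exp (η * (a i + 2 * s j)) * wt (V i ∩ A j) +
            Real.exp (η * a i) * wt (V i \ A j)) +
          ∑ i, (Real.exp (η * (a i - 2 * s j)) * wt (V i ∩ A j) +
            Real.exp (η * a i) * wt (V i \ A j))) / 2 ≤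
          Real.cosh (2 * η) * ρ * ∑ i, Real.exp (η * a i) * wt (V i) := by
        rw [← Finset.sum_add_distrib, Finset.sum_div, Finset.mul_sum]
        refine Finset.sum_le_sum fun i _ => ?_
        have e1 : Real.exp (η * (a i + 2 * s j)) =
            Real.exp (η * a i) * Real.exp (η * (2 * s j)) := by rw [← Real.exp_add]; ring_nf
        have e2 : Real.exp (η * (a i - 2 * s j)) =
            Real.exp (η * a i) * Real.exp (-(η * (2 * s j))) := by rw [← Real.exp_add]; ring_nf
        rw [e1, e2]
        calc _ = Real.exp (η * a i) *
              (Real.cosh (2 * η) * wt (V i ∩ A j) + 1 * wt (V i \ A j)) := by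
              rw [hcosh]; ring
          _ ≤ Real.exp (η * a i) * (Real.cosh (2 * η) * wt (V i ∩ A j) +
              Real.cosh (2 * η) * wt (V i \ A j)) := by
              gcongr
              · exact hwt _
              · exact Real.one_le_cosh _
          _ = Real.exp (η * a i) * Real.cosh (2 * η) * (wt (V i ∩ A j) + wt (V i \ A j)) := by ring
          _ ≤ Real.exp (η * a i) * Real.cosh (2 * η) * (ρ * wt (V i)) := by
              gcongr; exact hsplit _ _
          _ = _ := by ring
      have hconv := convexOn_exp.2 (Set.mem_univ (η * potential u n (L + (2 : ℝ) • u j)))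
        (Set.mem_univ (η * potential u n (L - (2 : ℝ) • u j)))
        (by norm_num : (0 : ℝ) ≤ 1 / 2) (by norm_num : (0 : ℝ) ≤ 1 / 2) (by norm_num)
      simp only [smul_eq_mul] at hconv
      calc _ = Real.exp (1 / 2 * (η * potential u n (L + (2 : ℝ) • u j)) +
            1 / 2 * (η * potential u n (L - (2 : ℝ) • u j))) := by ring_nf
        _ ≤ _ := hconv
        _ ≤ (Real.cosh (2 * η) * ρ) ^ n *
            (Real.cosh (2 * η) * ρ * ∑ i, Real.exp (η * a i) * wt (V i)) := by
            refine le_trans ?_ (mul_le_mul_of_nonneg_left hsum (pow_nonneg hC n))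
            linarith
        _ = Z := by rw [hZdef, pow_succ]; ring
    have hZ := (Real.exp_pos _).trans_le (hj (Classical.arbitrary J))
    refine key _ _ hZ (ciSup_le fun j => ?_)
    rw [le_div_iff₀' hη, Real.le_log_iff_exp_le hZ]
    exact hj j

end Potential

/-! ### Littlestone dimension and its exponential weight -/

section Littlestone

theorem MistakeTree.Shattered.mono {W : Type*} {n : ℕ} {t : MistakeTree W n}
    {H H' : Set (W → Bool)} (h : t.Shattered H) (hH : H ⊆ H') : t.Shattered H' := fun s hs =>
  let ⟨f, hf, hfs⟩ := h s hs
  ⟨f, hH hf, hfs⟩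

theorem MistakeTree.exists_shattered_zero {W : Type*} {H : Set (W → Bool)} (hH : H.Nonempty) :
    ∃ t : MistakeTree W 0, t.Shattered H := by
  obtain ⟨h, hh⟩ := hH
  refine ⟨.leaf, fun s hs => ⟨h, hh, ?_⟩⟩
  simp only [MistakeTree.paths, Set.mem_singleton_iff] at hs
  simp [hs]

theorem MistakeTree.Shattered.node {W : Type*} {n : ℕ} {l r : MistakeTree W n} {w : W}
    {H : Set (W → Bool)} (hl : l.Shattered {h ∈ H | h w = false})
    (hr : r.Shattered {h ∈ H | h w = true}) : (MistakeTree.node w l r).Shattered H := by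
  rintro _ (⟨s, hs, rfl⟩ | ⟨s, hs, rfl⟩)
  · obtain ⟨h, ⟨hH, hw⟩, hh⟩ := hl s hs
    exact ⟨h, hH, by simpa [hw] using hh⟩
  · obtain ⟨h, ⟨hH, hw⟩, hh⟩ := hr s hs
    exact ⟨h, hH, by simpa [hw] using hh⟩

theorem MistakeTree.Shattered.le_littlestoneDim {W : Type*} {n : ℕ} {t : MistakeTree W n}
    {H : Set (W → Bool)} (h : t.Shattered H) : (n : ℕ∞) ≤ littlestoneDim H :=
  le_iSup₂ (f := fun (n : ℕ) (_ : n ∈ {n : ℕ | ∃ t : MistakeTree W n, t.Shattered H}) => (n : ℕ∞))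
    n ⟨t, h⟩

/-- The Littlestone dimension as a natural number, meaningful if it is finite. -/
def natLittlestoneDim {W : Type*} (H : Set (W → Bool)) : ℕ :=
  sSup {n : ℕ | ∃ t : MistakeTree W n, t.Shattered H}

variable {W : Type*} {H : Set (W → Bool)} {ℓ : ℕ}

theorem bddAbove_shattered (h : littlestoneDim H ≤ ℓ) :
    BddAbove {n : ℕ | ∃ t : MistakeTree W n, t.Shattered H} :=
  ⟨ℓ, fun _ ⟨_, ht⟩ => by exact_mod_cast ht.le_littlestoneDim.trans h⟩

theorem littlestoneDim_mono {H' : Set (W → Bool)} (h : H ⊆ H') :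
    littlestoneDim H ≤ littlestoneDim H' :=
  iSup₂_le fun _ ⟨_, ht⟩ => (ht.mono h).le_littlestoneDim

theorem exists_shattered_natLittlestoneDim (hH : H.Nonempty) (h : littlestoneDim H ≤ ℓ) :
    ∃ t : MistakeTree W (natLittlestoneDim H), t.Shattered H :=
  Nat.sSup_mem (s := {n : ℕ | ∃ t : MistakeTree W n, t.Shattered H})
    ⟨0, MistakeTree.exists_shattered_zero hH⟩ (bddAbove_shattered h)

theorem natLittlestoneDim_le (hH : H.Nonempty) (h : littlestoneDim H ≤ ℓ) :
    natLittlestoneDim H ≤ ℓ := by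
  obtain ⟨t, ht⟩ := exists_shattered_natLittlestoneDim hH h
  exact_mod_cast ht.le_littlestoneDim.trans h

theorem natLittlestoneDim_mono {H' : Set (W → Bool)} (hH : H.Nonempty)
    (h : littlestoneDim H' ≤ ℓ) (hHH' : H ⊆ H') : natLittlestoneDim H ≤ natLittlestoneDim H' := by
  obtain ⟨t, ht⟩ := exists_shattered_natLittlestoneDim hH ((littlestoneDim_mono hHH').trans h)
  exact le_csSup (bddAbove_shattered h) ⟨t, ht.mono hHH'⟩

/-- If both parts kept the full dimension, joining their shattered trees under a root `w` would give
a deeper one. -/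
theorem natLittlestoneDim_split (h : littlestoneDim H ≤ ℓ) (w : W)
    (h0 : {f ∈ H | f w = false}.Nonempty) (h1 : {f ∈ H | f w = true}.Nonempty) :
    natLittlestoneDim {f ∈ H | f w = false} < natLittlestoneDim H ∨
      natLittlestoneDim {f ∈ H | f w = true} < natLittlestoneDim H := by
  by_contra! hc
  have e0 := hc.1.antisymm' (natLittlestoneDim_mono h0 h (Set.sep_subset _ _))
  have e1 := hc.2.antisymm' (natLittlestoneDim_mono h1 h (Set.sep_subset _ _))
  have hl := exists_shattered_natLittlestoneDim h0
    ((littlestoneDim_mono (Set.sep_subset _ _)).trans h)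
  have hr := exists_shattered_natLittlestoneDim h1
    ((littlestoneDim_mono (Set.sep_subset _ _)).trans h)
  rw [e0] at hl
  rw [e1] at hr
  obtain ⟨l, hl⟩ := hl
  obtain ⟨r, hr⟩ := hr
  have : natLittlestoneDim H + 1 ≤ natLittlestoneDim H :=
    le_csSup (bddAbove_shattered h) ⟨_, hl.node hr⟩
  omega

open Classical in
/-- The weight `K ^ (Littlestone dimension)` of a class, and `0` for the empty class. -/
def littlestoneWeight (K : ℝ) (H : Set (W → Bool)) : ℝ :=
  if H.Nonempty then K ^ natLittlestoneDim H else 0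

theorem littlestoneWeight_of_nonempty (K : ℝ) (hH : H.Nonempty) :
    littlestoneWeight K H = K ^ natLittlestoneDim H := if_pos hH

theorem littlestoneWeight_of_not_nonempty (K : ℝ) (hH : ¬ H.Nonempty) :
    littlestoneWeight K H = 0 := if_neg hH

theorem littlestoneWeight_nonneg {K : ℝ} (hK : 1 ≤ K) : 0 ≤ littlestoneWeight K H := by
  rw [littlestoneWeight]; split_ifs <;> positivity

theorem littlestoneWeight_mono {K : ℝ} (hK : 1 ≤ K) {H' : Set (W → Bool)}
    (h : littlestoneDim H' ≤ ℓ) (hHH' : H ⊆ H') :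
    littlestoneWeight K H ≤ littlestoneWeight K H' := by
  by_cases hH : H.Nonempty
  · rw [littlestoneWeight_of_nonempty K hH, littlestoneWeight_of_nonempty K (hH.mono hHH')]
    exact pow_le_pow_right₀ hK (natLittlestoneDim_mono hH h hHH')
  · rw [littlestoneWeight_of_not_nonempty K hH]
    exact littlestoneWeight_nonneg hK

/-- One part loses a dimension, hence a factor `K` of weight; the other is bounded by monotonicity.
An empty part has weight 0. -/
theorem littlestoneWeight_split {K : ℝ} (hK : 1 ≤ K) (h : littlestoneDim H ≤ ℓ) (w : W) :
    littlestoneWeight K {f ∈ H | f w = true} + littlestoneWeight K {f ∈ H | f w = false} ≤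
      (1 + 1 / K) * littlestoneWeight K H := by
  have hK0 : 0 < K := by linarith
  have hnn : 0 ≤ 1 / K * littlestoneWeight K H :=
    mul_nonneg (by positivity) (littlestoneWeight_nonneg hK)
  have m0 := littlestoneWeight_mono hK h (Set.sep_subset H fun f => f w = false)
  have m1 := littlestoneWeight_mono hK h (Set.sep_subset H fun f => f w = true)
  by_cases h0 : {f ∈ H | f w = false}.Nonempty
  swap
  · rw [littlestoneWeight_of_not_nonempty K h0]; linarith
  by_cases h1 : {f ∈ H | f w = true}.Nonempty
  swap
  · rw [littlestoneWeight_of_not_nonempty K h1]; linarith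
  have hH := h0.mono (Set.sep_subset _ _)
  have key : ∀ m : ℕ, m < natLittlestoneDim H → K ^ m ≤ 1 / K * littlestoneWeight K H := by
    intro m hm
    rw [littlestoneWeight_of_nonempty K hH, one_div, inv_mul_eq_div, le_div_iff₀ hK0, ← pow_succ]
    exact pow_le_pow_right₀ hK hm
  rcases natLittlestoneDim_split h w h0 h1 with hlt | hlt
  · rw [littlestoneWeight_of_nonempty K h0]; linarith [key _ hlt]
  · rw [littlestoneWeight_of_nonempty K h1]; linarith [key _ hlt]

end Littlestone

/-! ### Replies as moves, and the potential of a class -/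

section Moves

variable {X : Type*}

/-- The function on `X` that is played by a reply: the distinguisher with the sign of the bit. -/
def move (r : Reply X) (x : X) : ℝ :=
  (if r.2 then 1 else -1) * {x | r.1 x = true}.indicator 1 x

/-- The moves that come from a class of distinguishers. -/
def classMove (D : Set (X → Bool)) (j : D × Bool) : X → ℝ := move (j.1.1, j.2)

theorem abs_move_le (r : Reply X) (x : X) : |move r x| ≤ 1 := by
  by_cases h : r.1 x = true <;> cases hb : r.2 <;> simp [move, h, hb]

/-- The total of the moves in a list of replies. -/
def cumulativeMove (h : List (Reply X)) : X → ℝ := (h.map move).sum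

theorem cumulativeMove_cons (r : Reply X) (h : List (Reply X)) :
    cumulativeMove (r :: h) = cumulativeMove h + move r := by
  simp [cumulativeMove, add_comm]

theorem bddAbove_range_cumulativeMove (h : List (Reply X)) :
    BddAbove (Set.range (cumulativeMove h)) := by
  induction h with
  | nil => exact ⟨0, by rintro _ ⟨x, rfl⟩; simp [cumulativeMove]⟩
  | cons r h ih =>
    rw [cumulativeMove_cons]
    exact bddAbove_range_of_le_add ih (C := 1) fun x => by
      simp only [Pi.add_apply]
      linarith [(abs_le.1 (abs_move_le r x)).2]

variable {D : Set (X → Bool)} {ℓ : ℕ}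

theorem mul_potential_classMove_le [Nonempty X] [Nonempty D] (hD : dualLittlestoneDim D ≤ ℓ)
    {η K : ℝ} (hη : 0 < η) (hK : 1 ≤ K) (n : ℕ) :
    η * potential (classMove D) n 0 ≤ n * (2 * η ^ 2 + 1 / K) + ℓ * Real.log K := by
  have hK0 : 0 < K := by linarith
  set ev : X → D → Bool := fun x d => d.1 x with hev
  have hle : ∀ V : Set X, littlestoneDim (ev '' V) ≤ ℓ := fun V =>
    (littlestoneDim_mono (Set.image_subset_range _ _)).trans hD
  have hmain := exp_potential_le (u := classMove D) (η := η) (ρ := 1 + 1 / K)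
    (wt := fun V => littlestoneWeight K (ev '' V)) (by positivity) hη
    (fun V => littlestoneWeight_nonneg hK)
    (fun V hV => by
      rw [littlestoneWeight_of_nonempty K (hV.image ev)]; exact one_le_pow₀ hK)
    (A := fun j => {x | j.1.1 x = true}) (s := fun j => if j.2 then 1 else -1)
    (fun j => by cases j.2 <;> simp) (fun j x => rfl)
    (fun V j => by
      have h1 : ev '' (V ∩ {x | j.1.1 x = true}) = {f ∈ ev '' V | f j.1 = true} := by
        ext f
        constructor
        · rintro ⟨x, ⟨hx, hjx⟩, rfl⟩; exact ⟨⟨x, hx, rfl⟩, hjx⟩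
        · rintro ⟨⟨x, hx, rfl⟩, hjx⟩; exact ⟨x, ⟨hx, hjx⟩, rfl⟩
      have h2 : ev '' (V \ {x | j.1.1 x = true}) = {f ∈ ev '' V | f j.1 = false} := by
        ext f
        constructor
        · rintro ⟨x, ⟨hx, hjx⟩, rfl⟩; exact ⟨⟨x, hx, rfl⟩, by simpa using hjx⟩
        · rintro ⟨⟨x, hx, rfl⟩, hjx⟩; exact ⟨x, ⟨hx, by simpa using hjx⟩, rfl⟩
      simp only [h1, h2]
      exact littlestoneWeight_split hK (hle V) j.1)
    -- The induction starts from the trivial cover by one cell with payoff bound 0.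
    n (ι := Unit) (fun _ => Set.univ) (fun _ => 0) 0 (fun x => ⟨(), trivial⟩)
    (fun _ x _ => le_rfl)
  simp only [Finset.univ_unique, Finset.sum_singleton, mul_zero, Real.exp_zero, one_mul] at hmain
  have hne : (ev '' Set.univ).Nonempty := Set.univ_nonempty.image ev
  rw [← Real.exp_le_exp]
  refine hmain.trans ?_
  rw [Real.exp_add, Real.exp_nat_mul, mul_comm (ℓ : ℝ), Real.exp_mul, Real.exp_log hK0,
    Real.rpow_natCast]
  gcongr
  · exact littlestoneWeight_nonneg hK
  · rw [Real.exp_add]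
    gcongr
    · refine (Real.cosh_le_exp_half_sq _).trans_eq ?_
      ring_nf
    · linarith [Real.add_one_le_exp (1 / K)]
  · rw [littlestoneWeight_of_nonempty K hne]
    exact pow_le_pow_right₀ hK (natLittlestoneDim_le hne (hle _))

theorem potential_classMove_le [Nonempty X] [Nonempty D] (hD : dualLittlestoneDim D ≤ ℓ)
    {γ K : ℝ} (hγ : 0 < γ) (hK : 1 ≤ K) (hKγ : 32 / γ ^ 2 ≤ K) (n : ℕ) :
    potential (classMove D) n 0 ≤ n * γ / 2 + 8 * ℓ * Real.log K / γ := by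
  -- With `η = γ / 8` the terms `2 η ^ 2` and `1 / K` are each at most `γ ^ 2 / 32`; their sum
  -- divided by `η` is at most `γ / 2`.
  have h := mul_potential_classMove_le hD (η := γ / 8) (by positivity) hK n
  have hK2 : 1 / K ≤ γ ^ 2 / 32 := by
    rw [div_le_iff₀ (by positivity)] at hKγ
    rw [div_le_iff₀ (by linarith)]
    linarith
  have h2 : γ / 8 * potential (classMove D) n 0 ≤
      γ / 8 * (n * γ / 2 + 8 * ℓ * Real.log K / γ) := by
    have : (n : ℝ) * (2 * (γ / 8) ^ 2 + 1 / K) ≤ n * (2 * (γ / 8) ^ 2 + γ ^ 2 / 32) := by gcongr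
    refine (h.trans (add_le_add_left this _)).trans_eq ?_
    field_simp
    ring
  exact le_of_mul_le_mul_left h2 (by positivity)

theorem potential_classMove_lt [Nonempty X] [Nonempty D] (hD : dualLittlestoneDim D ≤ ℓ)
    {γ K : ℝ} (hγ : 0 < γ) (hK : 1 ≤ K) (hKγ : 32 / γ ^ 2 ≤ K) {n : ℕ}
    (hn : 16 * ℓ * Real.log K / γ ^ 2 < n) :
    potential (classMove D) n 0 < n * γ := by
  refine (potential_classMove_le hD hγ hK hKγ n).trans_lt ?_
  have : 8 * ℓ * Real.log K / γ = 16 * ℓ * Real.log K / γ ^ 2 * (γ / 2) := by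
    field_simp; ring
  rw [this]
  have := mul_lt_mul_of_pos_right hn (half_pos hγ)
  linarith

end Moves

/-! ### The game: generator strategy, adversary, and constants -/

section Game

variable {X : Type*} [MeasurableSpace X]

theorem measurableSet_eq_true {d : X → Bool} (hd : Measurable d) :
    MeasurableSet {x | d x = true} := hd (measurableSet_singleton true)

theorem prob_nonneg (p : ProbabilityMeasure X) (d : X → Bool) : 0 ≤ prob p d := measureReal_nonneg

theorem prob_le_one (p : ProbabilityMeasure X) (d : X → Bool) : prob p d ≤ 1 := measureReal_le_one

theorem abs_prob_sub_prob_le (p q : ProbabilityMeasure X) (d : X → Bool) :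
    |prob p d - prob q d| ≤ 1 :=
  abs_le.2 ⟨by linarith [prob_nonneg p d, prob_le_one q d],
    by linarith [prob_nonneg q d, prob_le_one p d]⟩

theorem le_ipm {D : Set (X → Bool)} {d : X → Bool} (hd : d ∈ D) (p q : ProbabilityMeasure X) :
    |prob p d - prob q d| ≤ ipm D p q :=
  le_ciSup (f := fun d : D => |prob p d.1 - prob q d.1|)
    ⟨1, by rintro _ ⟨d, rfl⟩; exact abs_prob_sub_prob_le p q d⟩ ⟨d, hd⟩

theorem ipm_le {D : Set (X → Bool)} {p q : ProbabilityMeasure X} {ε : ℝ} (hε : 0 ≤ ε)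
    (h : ∀ d ∈ D, |prob p d - prob q d| ≤ ε) : ipm D p q ≤ ε :=
  Real.iSup_le (fun d => h d.1 d.2) hε

/-- The Dirac measure as a probability measure. -/
def diracProb (x : X) : ProbabilityMeasure X := ⟨Measure.dirac x, inferInstance⟩

theorem prob_diracProb (x : X) {d : X → Bool} (hd : Measurable d) :
    prob (diracProb x) d = {x | d x = true}.indicator 1 x := by
  simp only [prob, diracProb, ProbabilityMeasure.coe_mk, Measure.real,
    Measure.dirac_apply' x (measurableSet_eq_true hd)]
  by_cases h : d x = true <;> simp [h]

theorem exists_probabilityMeasure_of_mem_finiteMeans {φ : (X → ℝ) →ₗ[ℝ] ℝ}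
    (hφ : φ ∈ finiteMeans X) : ∃ p : ProbabilityMeasure X, ∀ d : X → Bool, Measurable d →
      prob p d = φ ({x | d x = true}.indicator 1) := by
  refine convexHull_min (t := {φ : (X → ℝ) →ₗ[ℝ] ℝ | ∃ p : ProbabilityMeasure X,
    ∀ d : X → Bool, Measurable d → prob p d = φ ({x | d x = true}.indicator 1)}) ?_ ?_ hφ
  · rintro _ ⟨x, rfl⟩
    exact ⟨diracProb x, fun d hd => prob_diracProb x hd⟩
  · rintro φ ⟨p, hp⟩ ψ ⟨q, hq⟩ a b ha hb hab
    have hprob : IsProbabilityMeasure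
        (ENNReal.ofReal a • (p : Measure X) + ENNReal.ofReal b • (q : Measure X)) := by
      constructor
      simp [← ENNReal.ofReal_add ha hb, hab]
    refine ⟨⟨_, hprob⟩, fun d hd => ?_⟩
    have h1 := hp d hd
    have h2 := hq d hd
    simp only [prob, ProbabilityMeasure.coe_mk] at h1 h2 ⊢
    rw [LinearMap.add_apply, LinearMap.smul_apply, LinearMap.smul_apply, ← h1, ← h2,
      measureReal_add_apply (ENNReal.mul_ne_top ENNReal.ofReal_ne_top (measure_ne_top _ _))
        (ENNReal.mul_ne_top ENNReal.ofReal_ne_top (measure_ne_top _ _)),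
      measureReal_ennreal_smul_apply, measureReal_ennreal_smul_apply,
      ENNReal.toReal_ofReal ha, ENNReal.toReal_ofReal hb]
    rfl

/-- The value of a move under a probability measure. -/
def moveValue (p : ProbabilityMeasure X) (r : Reply X) : ℝ :=
  (if r.2 then 1 else -1) * prob p r.1

theorem exists_probabilityMeasure_moveValue {φ : (X → ℝ) →ₗ[ℝ] ℝ} (hφ : φ ∈ finiteMeans X) :
    ∃ p : ProbabilityMeasure X, ∀ r : Reply X, Measurable r.1 → moveValue p r = φ (move r) := by
  obtain ⟨p, hp⟩ := exists_probabilityMeasure_of_mem_finiteMeans hφ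
  refine ⟨p, fun r hr => ?_⟩
  have : move r = (if r.2 then (1 : ℝ) else -1) • ({x | r.1 x = true}.indicator 1 : X → ℝ) := rfl
  rw [this, map_smul, moveValue, hp _ hr, smul_eq_mul]

theorem integrable_move (q : ProbabilityMeasure X) {r : Reply X} (hr : Measurable r.1) :
    Integrable (move r) (q : Measure X) :=
  ((integrable_const (1 : ℝ)).indicator (measurableSet_eq_true hr)).const_mul _

theorem integral_move (q : ProbabilityMeasure X) {r : Reply X} (hr : Measurable r.1) :
    ∫ x, move r x ∂(q : Measure X) = moveValue q r := by
  simp only [move, moveValue, integral_const_mul, prob]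
  rw [integral_indicator_one (measurableSet_eq_true hr)]

theorem integral_cumulativeMove (q : ProbabilityMeasure X) (h : List (Reply X))
    (hm : ∀ r ∈ h, Measurable r.1) : Integrable (cumulativeMove h) (q : Measure X) ∧
      ∫ x, cumulativeMove h x ∂(q : Measure X) = (h.map (moveValue q)).sum := by
  induction h with
  | nil =>
    simp only [cumulativeMove, List.map_nil, List.sum_nil]
    exact ⟨integrable_zero _ _ _, by simp⟩
  | cons r h ih =>
    obtain ⟨h1, h2⟩ := ih fun r hr => hm r (List.mem_cons_of_mem _ hr)
    have hr := hm r List.mem_cons_self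
    rw [cumulativeMove_cons]
    refine ⟨h1.add (integrable_move q hr), ?_⟩
    simp only [Pi.add_apply]
    rw [integral_add h1 (integrable_move q hr), h2, integral_move q hr, List.map_cons,
      List.sum_cons, add_comm]

theorem sum_moveValue_le (q : ProbabilityMeasure X) (h : List (Reply X))
    (hm : ∀ r ∈ h, Measurable r.1) :
    (h.map (moveValue q)).sum ≤ ⨆ x, cumulativeMove h x := by
  obtain ⟨h1, h2⟩ := integral_cumulativeMove q h hm
  rw [← h2]
  calc _ ≤ ∫ _, (⨆ x, cumulativeMove h x) ∂(q : Measure X) :=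
        integral_mono h1 (integrable_const _)
          fun x => le_ciSup (bddAbove_range_cumulativeMove h) x
    _ = _ := by simp

theorem exists_tails_map_eq_cons {α β : Type*} (f : List α → β) (h : List α) :
    ∃ ps, h.tails.map f = f h :: ps ∧ ps.length = h.length := by
  cases h <;> simp

variable {D : Set (X → Bool)}

/-- The bit orients the distinguisher so that the target always has the larger value. -/
theorem Discriminator.IsLegal.lt_moveValue_sub {ε : ℝ} {B : Discriminator X} (hB : B.IsLegal D ε)
    {q p : ProbabilityMeasure X} {ps : List (ProbabilityMeasure X)} {r : Reply X}
    (h : B q (p :: ps) = some r) : r.1 ∈ D ∧ ε < moveValue q r - moveValue p r := by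
  obtain ⟨h1, h2⟩ := hB q p ps
  have hlt : ε < ipm D p q := by
    by_contra! hc
    rw [h1 hc] at h
    exact absurd h (by simp)
  obtain ⟨d, hd, b, hdb, habs, hb⟩ := h2 hlt
  obtain rfl : (d, b) = r := Option.some_injective _ (hdb.symm.trans h)
  refine ⟨hd, ?_⟩
  simp only [moveValue]
  cases b
  · have : ¬ prob p d < prob q d := fun hlt => by simpa using hb.2 hlt
    rw [abs_of_nonpos (by linarith)] at habs
    simp only [Bool.false_eq_true, if_false]
    linarith
  · have : prob p d < prob q d := hb.1 rfl
    rw [abs_of_pos (by linarith)] at habs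
    simp only [if_true]
    linarith

theorem fooledWithin_of_potential_lt [Nonempty X] [Nonempty D] (hD : ∀ d ∈ D, Measurable d)
    (hgrow : ∀ γ : ℝ, 0 < γ → ∃ n : ℕ, potential (classMove D) n 0 < n * γ) {ε : ℝ} (hε : 0 < ε)
    {N : ℕ} (hN : potential (classMove D) N 0 < N * (ε / 2)) : FooledWithin D ε N := by
  have hu : ∀ j x, |classMove D j x| ≤ 1 := fun j x => abs_move_le _ x
  have hG : ∀ h : List (Reply X), ∃ p : ProbabilityMeasure X, ∀ r : Reply X, r.1 ∈ D →
      potential (classMove D) (N - 1 - h.length) (cumulativeMove h + move r) - moveValue p r ≤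
        potential (classMove D) (N - 1 - h.length + 1) (cumulativeMove h) + ε / 2 := fun h => by
    obtain ⟨φ, hφ, hle⟩ := exists_finiteMeans_potential_le hu hgrow (N - 1 - h.length)
      (bddAbove_range_cumulativeMove h) (half_pos hε)
    obtain ⟨p, hp⟩ := exists_probabilityMeasure_moveValue hφ
    refine ⟨p, fun r hr => ?_⟩
    rw [hp r (hD _ hr)]
    exact hle (⟨r.1, hr⟩, r.2)
  choose G hG using hG
  refine ⟨G, fun B hB q => ?_⟩
  -- Each surviving round gains `ε` from legality and loses at most `ε / 2` to the near-optimality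
  -- of the move. At `t = N` the potential is the supremum of the total move, which dominates the
  -- target's total, so `N * (ε / 2) ≤ potential N 0`, a contradiction.
  have hinv : ∀ t ≤ N, ∀ h, play G B q t = some h → h.length = t ∧ (∀ r ∈ h, r.1 ∈ D) ∧
      potential (classMove D) (N - t) (cumulativeMove h) + t * ε ≤
        potential (classMove D) N 0 + t * (ε / 2) + (h.map (moveValue q)).sum := by
    intro t
    induction t with
    | zero =>
      intro _ h hh
      simp only [play, Option.some.injEq] at hh
      subst hh
      simp [cumulativeMove]
    | succ t ih =>
      intro ht h' hh'
      simp only [play, Option.bind_eq_some_iff, Option.map_eq_some_iff] at hh'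
      obtain ⟨h, hh, r, hr, rfl⟩ := hh'
      obtain ⟨hlen, hmem, hpot⟩ := ih (by omega) h hh
      obtain ⟨ps, hps, -⟩ := exists_tails_map_eq_cons G h
      rw [hps] at hr
      obtain ⟨hrD, hlt⟩ := hB.lt_moveValue_sub hr
      have hstep := hG h r hrD
      rw [hlen, show N - 1 - t + 1 = N - t by omega, show N - 1 - t = N - (t + 1) by omega] at hstep
      refine ⟨by simp [hlen], ?_, ?_⟩
      · intro s hs
        rcases List.mem_cons.1 hs with rfl | hs
        · exact hrD
        · exact hmem s hs
      · rw [cumulativeMove_cons, List.map_cons, List.sum_cons]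
        push_cast
        linarith
  rcases hplay : play G B q N with _ | h
  · rfl
  · obtain ⟨-, hmem, hpot⟩ := hinv N le_rfl h hplay
    have := sum_moveValue_le q h fun r hr => hD _ (hmem r hr)
    rw [Nat.sub_self, potential] at hpot
    linarith

theorem fooledWithin_one {ε : ℝ} (p : ProbabilityMeasure X)
    (h : ∀ q, ipm D p q ≤ ε) : FooledWithin D ε 1 :=
  ⟨fun _ => p, fun B hB q => by simp [play, (hB q p []).1 (h q)]⟩

theorem roundComplexity_le {ε : ℝ} {T : ℕ} (h : FooledWithin D ε T) :
    roundComplexity D ε ≤ T :=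
  iInf₂_le (f := fun (T : ℕ) (_ : T ∈ {T : ℕ | FooledWithin D ε T}) => (T : ℕ∞)) T h

theorem fooledWithin_one_of_one_le [Nonempty X] {ε : ℝ} (hε : 1 ≤ ε) : FooledWithin D ε 1 :=
  fooledWithin_one (diracProb (Classical.arbitrary X)) fun q =>
    ipm_le (by linarith) fun d _ => (abs_prob_sub_prob_le _ q d).trans hε

/-- A nonconstant distinguisher would be the root of a shattered tree of depth one, so all are
constant and no two measures can be told apart. -/
theorem fooledWithin_one_of_dualLittlestoneDim_eq_zero [Nonempty X]
    (h0 : dualLittlestoneDim D = 0) {ε : ℝ} (hε : 0 < ε) : FooledWithin D ε 1 := by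
  have hconst : ∀ d ∈ D, ∀ x y, d x = true → d y = true := fun d hd x y hx => by
    by_contra hy
    have hne : ∀ z, (fun d : D => d.1 z) ∈ dualClass D := fun z => ⟨z, rfl⟩
    have : (MistakeTree.node (⟨d, hd⟩ : D) .leaf .leaf).Shattered (dualClass D) := by
      rintro _ (⟨s, hs, rfl⟩ | ⟨s, hs, rfl⟩)
      · simp only [MistakeTree.paths, Set.mem_singleton_iff] at hs
        exact ⟨_, hne y, by simpa [hs] using hy⟩
      · simp only [MistakeTree.paths, Set.mem_singleton_iff] at hs
        exact ⟨_, hne x, by simpa [hs] using hx⟩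
    have hle := this.le_littlestoneDim
    rw [← dualLittlestoneDim, h0] at hle
    simp at hle
  refine fooledWithin_one (diracProb (Classical.arbitrary X)) fun q =>
    ipm_le hε.le fun d hd => ?_
  have : ∀ p : ProbabilityMeasure X, prob p d =
      if d (Classical.arbitrary X) = true then 1 else 0 := fun p => by
    split_ifs with h
    · have : {x | d x = true} = Set.univ := Set.eq_univ_of_forall fun y => hconst d hd _ y h
      simp [prob, this]
    · have : {x | d x = true} = ∅ := Set.eq_empty_of_forall_notMem fun y hy => h (hconst d hd y _ hy)
      simp [prob, this]
  rw [this, this, sub_self, abs_zero]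
  exact hε.le

/-- A path in a mistake tree along which every submission of `G` assigns at least `1 / 2` to the
wrong answer. -/
theorem MistakeTree.exists_adversarial_path (G : Generator X) {n : ℕ} (t : MistakeTree D n) :
    ∀ h : List (Reply X), ∃ s ∈ t.paths, s.length = n ∧ ∀ i (hi : i < s.length),
      (s[i].2 = true ↔
        prob (G (((s.take i).map fun e => ((e.1.1, e.2) : Reply X)).reverse ++ h)) s[i].1.1
          ≤ 1 / 2) := by
  induction t with
  | leaf => intro h; exact ⟨[], by simp [MistakeTree.paths], rfl, by simp⟩
  | @node n w l r ihl ihr =>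
    intro h
    -- The branch taken is the answer to which the submission gives probability at most 1/2; it also
    -- becomes the next reply.
    by_cases hp : prob (G h) w.1 ≤ 1 / 2
    · obtain ⟨s, hs, hlen, hi⟩ := ihr ((w.1, true) :: h)
      refine ⟨(w, true) :: s, Or.inr ⟨s, hs, rfl⟩, by simp [hlen], ?_⟩
      rintro (_ | i) hlt
      · simpa using hp
      · simpa using hi i (by simpa using hlt)
    · obtain ⟨s, hs, hlen, hi⟩ := ihl ((w.1, false) :: h)
      refine ⟨(w, false) :: s, Or.inl ⟨s, hs, rfl⟩, by simp [hlen], ?_⟩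
      rintro (_ | i) hlt
      · simpa using hp
      · simpa using hi i (by simpa using hlt)

/-- A legal discriminator that prefers to reply with the prescribed distinguishers. -/
theorem exists_isLegal_of_list (D : Set (X → Bool)) {ε : ℝ} (hε : 0 ≤ ε) (s : List D) :
    ∃ B : Discriminator X, B.IsLegal D ε ∧ ∀ q p ps (hi : ps.length < s.length),
      ε < |prob q s[ps.length].1 - prob p s[ps.length].1| →
        B q (p :: ps) = some (s[ps.length].1,
          decide (prob p s[ps.length].1 < prob q s[ps.length].1)) := by
  classical
  have : ∀ (q : ProbabilityMeasure X) (l : List (ProbabilityMeasure X)),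
      ∃ o : Option (Reply X), ∀ p ps, l = p :: ps → (ipm D p q ≤ ε → o = none) ∧
        (ε < ipm D p q → ∃ d ∈ D, ∃ b : Bool, o = some (d, b) ∧
          ε < |prob q d - prob p d| ∧ (b = true ↔ prob p d < prob q d)) ∧
        ∀ hi : ps.length < s.length, ε < |prob q s[ps.length].1 - prob p s[ps.length].1| →
          o = some (s[ps.length].1,
            decide (prob p s[ps.length].1 < prob q s[ps.length].1)) := by
    intro q l
    rcases l with _ | ⟨p, ps⟩
    · exact ⟨none, by simp⟩
    -- The number of earlier submissions tells the round, hence the prescribed distinguisher. Where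
    -- it does not distinguish, any legal reply serves.
    by_cases hs : ∃ hi : ps.length < s.length,
        ε < |prob q s[ps.length].1 - prob p s[ps.length].1|
    · obtain ⟨hi, hlt⟩ := hs
      refine ⟨some (s[ps.length].1, decide (prob p s[ps.length].1 < prob q s[ps.length].1)), ?_⟩
      rintro _ _ ⟨rfl, rfl⟩
      have hipm := le_ipm s[ps.length].2 p q
      rw [abs_sub_comm] at hipm
      exact ⟨fun hle => absurd (hlt.trans_le hipm) hle.not_gt,
        fun _ => ⟨_, s[ps.length].2, _, rfl, hlt, by simp⟩, fun _ _ => rfl⟩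
    by_cases hle : ipm D p q ≤ ε
    · refine ⟨none, ?_⟩
      rintro _ _ ⟨rfl, rfl⟩
      exact ⟨fun _ => rfl, fun hlt => absurd hle hlt.not_ge, fun hi h => absurd ⟨hi, h⟩ hs⟩
    · have hex : ∃ d ∈ D, ε < |prob q d - prob p d| := by
        by_contra! hc
        exact hle (ipm_le hε fun d hd => by rw [abs_sub_comm]; exact hc d hd)
      obtain ⟨d, hd, hlt⟩ := hex
      refine ⟨some (d, decide (prob p d < prob q d)), ?_⟩
      rintro _ _ ⟨rfl, rfl⟩
      exact ⟨fun h => absurd h hle, fun _ => ⟨d, hd, _, rfl, hlt, by simp⟩,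
        fun hi h => absurd ⟨hi, h⟩ hs⟩
  choose B hB using this
  exact ⟨B, fun q p ps => ⟨(hB q _ p ps rfl).1, (hB q _ p ps rfl).2.1⟩,
    fun q p ps => (hB q _ p ps rfl).2.2⟩

theorem MistakeTree.Shattered.lt_of_fooledWithin (hD : ∀ d ∈ D, Measurable d) {ε : ℝ} (hε : 0 < ε)
    (hε2 : ε < 1 / 2) {n : ℕ} {t : MistakeTree D n} (ht : t.Shattered (dualClass D)) {T : ℕ}
    (hT : FooledWithin D ε T) : n < T := by
  obtain ⟨G, hG⟩ := hT
  obtain ⟨s, hs, hlen, hpath⟩ := t.exists_adversarial_path G []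
  obtain ⟨_, ⟨x, rfl⟩, hx⟩ := ht s hs
  obtain ⟨B, hB, hBs⟩ := exists_isLegal_of_list D hε.le (s.map Prod.fst)
  -- The discriminator's replies reproduce the path, so the submissions are those against which the
  -- path was chosen. All `n` rounds pass without a win, hence `n < T`.
  have hplay : ∀ k ≤ n, play G B (diracProb x) k =
      some ((s.take k).map fun e => ((e.1.1, e.2) : Reply X)).reverse := by
    intro k
    induction k with
    | zero => intro _; simp [play]
    | succ k ih =>
      intro hk
      have hks : k < s.length := by omega
      set h := ((s.take k).map fun e => ((e.1.1, e.2) : Reply X)).reverse with hh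
      obtain ⟨ps, hps, hpsl⟩ := exists_tails_map_eq_cons G h
      have hpk : ps.length = k := by rw [hpsl]; simp [hh]; omega
      have hp := hpath k hks
      rw [List.append_nil, ← hh] at hp
      have hxk : s[k].1.1 x = s[k].2 := hx _ (List.getElem_mem hks)
      have hq := prob_diracProb x (hD _ s[k].1.2)
      have hval : ε < |prob (diracProb x) s[k].1.1 - prob (G h) s[k].1.1| ∧
          decide (prob (G h) s[k].1.1 < prob (diracProb x) s[k].1.1) = s[k].2 := by
        rw [hq]
        cases hb : s[k].2
        · rw [hb] at hxk hp
          have hlt : 1 / 2 < prob (G h) s[k].1.1 := not_le.1 fun hc => by simpa using hp.2 hc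
          rw [Set.indicator_of_notMem (by simp [hxk])]
          refine ⟨?_, by simpa using prob_nonneg _ _⟩
          rw [zero_sub, abs_neg]
          exact hε2.trans (hlt.trans_le (le_abs_self _))
        · rw [hb] at hxk hp
          have hle : prob (G h) s[k].1.1 ≤ 1 / 2 := hp.1 rfl
          rw [Set.indicator_of_mem (by exact hxk), Pi.one_apply]
          refine ⟨lt_of_lt_of_le ?_ (le_abs_self _), by simp; linarith⟩
          linarith
      have hBk : B (diracProb x) (G h :: ps) = some (s[k].1.1, s[k].2) := by
        have := hBs (diracProb x) (G h) ps (by simp; omega)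
        simp only [hpk, List.getElem_map] at this
        rw [this hval.1, hval.2]
      rw [play, ih (by omega), Option.bind_some, hps, hBk, Option.map_some,
        List.take_succ_eq_append_getElem hks, List.map_append, List.reverse_append, ← hh]
      rfl
  by_contra! hTn
  have := hG B hB (diracProb x)
  rw [hplay T hTn] at this
  simp at this

theorem dualLittlestoneDim_le_roundComplexity (hD : ∀ d ∈ D, Measurable d) {ε : ℝ} (hε : 0 < ε)
    (hε2 : ε < 1 / 2) : dualLittlestoneDim D ≤ roundComplexity D ε :=
  iSup₂_le fun _ ⟨_, ht⟩ => le_iInf₂ fun _ hT =>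
    Nat.cast_le.2 (ht.lt_of_fooledWithin hD hε hε2 hT).le

theorem exists_fooledWithin [Nonempty X] (hD : ∀ d ∈ D, Measurable d) {ℓ : ℕ}
    (hℓ : dualLittlestoneDim D = ℓ) {ε : ℝ} (hε : 0 < ε) :
    ∃ N : ℕ, FooledWithin D ε N ∧
      (N : ℝ) ≤ 1 + 640 * ((ℓ : ℝ) / ε ^ 2 * Real.log (2 + (ℓ : ℝ) / ε)) := by
  have hY : 0 ≤ (ℓ : ℝ) / ε ^ 2 * Real.log (2 + (ℓ : ℝ) / ε) := by
    have : 0 ≤ (ℓ : ℝ) / ε := by positivity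
    exact mul_nonneg (by positivity) (Real.log_nonneg (by linarith))
  have hone : ((1 : ℕ) : ℝ) ≤ 1 + 640 * ((ℓ : ℝ) / ε ^ 2 * Real.log (2 + (ℓ : ℝ) / ε)) := by
    push_cast; linarith
  rcases le_or_gt 1 ε with hε1 | hε1
  · exact ⟨1, fooledWithin_one_of_one_le hε1, hone⟩
  rcases Nat.eq_zero_or_pos ℓ with rfl | hℓ0
  · exact ⟨1, fooledWithin_one_of_dualLittlestoneDim_eq_zero (by simpa using hℓ) hε, hone⟩
  rcases D.eq_empty_or_nonempty with rfl | hDne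
  · exact ⟨1, fooledWithin_one (diracProb (Classical.arbitrary X))
      fun q => ipm_le hε.le (by simp), hone⟩
  have := hDne.to_subtype
  have hgrow : ∀ γ : ℝ, 0 < γ → ∃ n : ℕ, potential (classMove D) n 0 < n * γ := fun γ hγ => by
    obtain ⟨n, hn⟩ := exists_nat_gt (16 * ℓ * Real.log (max 1 (32 / γ ^ 2)) / γ ^ 2)
    exact ⟨n, potential_classMove_lt hℓ.le hγ (le_max_left _ _) (le_max_right _ _) hn⟩
  have hε2 : ε ^ 2 < 1 := by nlinarith
  have hεp : 0 < ε ^ 2 := by positivity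
  have hK : 1 ≤ 128 / ε ^ 2 := by rw [le_div_iff₀ hεp]; linarith
  -- This is the threshold of `potential_classMove_lt` at `γ = ε / 2`, with `K = 32 / γ ^ 2 = 128 /
  -- ε ^ 2`. Rounding up costs the summand 1, and the logarithm comparison below turns 64 into 640.
  set x : ℝ := 64 * ((ℓ : ℝ) / ε ^ 2 * Real.log (128 / ε ^ 2)) with hx
  have hx0 : 0 ≤ x := by
    have := Real.log_nonneg hK
    positivity
  refine ⟨⌊x⌋₊ + 1, fooledWithin_of_potential_lt hD hgrow hε
    (potential_classMove_lt hℓ.le (half_pos hε) hK (le_of_eq (by field_simp; ring)) ?_), ?_⟩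
  · push_cast
    refine lt_of_eq_of_lt ?_ (Nat.lt_floor_add_one x)
    rw [hx]
    field_simp
    ring
  · have hfl := Nat.floor_le hx0
    have hlog : Real.log (128 / ε ^ 2) ≤ 10 * Real.log (2 + (ℓ : ℝ) / ε) := by
      have h1 : (1 : ℝ) ≤ ℓ := by exact_mod_cast hℓ0
      have hz : 0 ≤ (ℓ : ℝ) / ε := by positivity
      have h2 : 1 / ε ≤ 2 + (ℓ : ℝ) / ε := by
        have : 1 / ε ≤ ℓ / ε := by gcongr
        linarith
      have h3 : 128 / ε ^ 2 ≤ (2 + (ℓ : ℝ) / ε) ^ 10 := by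
        calc 128 / ε ^ 2 ≤ 2 ^ 8 * (1 / ε) ^ 2 := by
              rw [div_pow, one_pow, mul_one_div]; gcongr; norm_num
          _ ≤ (2 + (ℓ : ℝ) / ε) ^ 8 * (2 + (ℓ : ℝ) / ε) ^ 2 := by
              gcongr
              linarith
          _ = _ := by ring
      have := Real.log_le_log (by positivity) h3
      rwa [Real.log_pow, Nat.cast_ofNat] at this
    have := mul_le_mul_of_nonneg_left hlog (show 0 ≤ (ℓ : ℝ) / ε ^ 2 by positivity)
    push_cast
    linarith

/-- Since `ℓ / ε ≥ 2`, adding 2 at most squares the argument of the logarithm, giving 1280. The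
summand 1 is absorbed because `ℓ / ε ^ 2 ≥ 4` and the logarithm is at least 1/2. -/
theorem one_add_mul_log_le_mul_log {ℓ : ℕ} (hℓ : 1 ≤ ℓ) {ε : ℝ} (hε : 0 < ε) (hε2 : ε ≤ 1 / 2) :
    1 + 640 * ((ℓ : ℝ) / ε ^ 2 * Real.log (2 + (ℓ : ℝ) / ε)) ≤
      1281 * ((ℓ : ℝ) / ε ^ 2 * Real.log ((ℓ : ℝ) / ε)) := by
  have h1 : (1 : ℝ) ≤ ℓ := by exact_mod_cast hℓ
  have hz : 2 ≤ (ℓ : ℝ) / ε := by rw [le_div_iff₀ hε]; linarith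
  have hy : 4 ≤ (ℓ : ℝ) / ε ^ 2 := by rw [le_div_iff₀ (by positivity)]; nlinarith
  have hlog : Real.log (2 + (ℓ : ℝ) / ε) ≤ 2 * Real.log ((ℓ : ℝ) / ε) := by
    have := Real.log_le_log (by linarith) (show 2 + (ℓ : ℝ) / ε ≤ ((ℓ : ℝ) / ε) ^ 2 by nlinarith)
    rwa [Real.log_pow, Nat.cast_ofNat] at this
  have hlog2 : 1 / 2 ≤ Real.log ((ℓ : ℝ) / ε) :=
    (by linarith [Real.log_two_gt_d9] : 1 / 2 ≤ Real.log 2).trans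
      (Real.log_le_log (by norm_num) hz)
  have := mul_le_mul_of_nonneg_left hlog (show 0 ≤ (ℓ : ℝ) / ε ^ 2 by linarith)
  nlinarith

end Game

end SequentialFooling

end

theorem theorem2 :
    -- upper bound, with an absolute constant `C`
    (∃ C : ℝ, 0 < C ∧
      ∀ (X : Type*) [MeasurableSpace X] [Nonempty X] (D : Set (X → Bool)),
        (∀ d ∈ D, Measurable d) →
        ∀ ℓ : ℕ, SequentialFooling.dualLittlestoneDim D = (ℓ : ℕ∞) →
        ∀ ε : ℝ, 0 < ε →
          ∃ T : ℕ, SequentialFooling.roundComplexity D ε = (T : ℕ∞) ∧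
            (1 ≤ ℓ → ε ≤ 1 / 2 → (T : ℝ) ≤ C * ((ℓ : ℝ) / ε ^ 2 * Real.log ((ℓ : ℝ) / ε))) ∧
            (T : ℝ) ≤ 1 + C * ((ℓ : ℝ) / ε ^ 2 * Real.log (2 + (ℓ : ℝ) / ε))) ∧
    -- lower bound, also for infinite dual Littlestone dimension
    (∀ (X : Type*) [MeasurableSpace X] [Nonempty X] (D : Set (X → Bool)),
        (∀ d ∈ D, Measurable d) →
        ∀ ε : ℝ, 0 < ε → ε < 1 / 2 →
          SequentialFooling.dualLittlestoneDim D ≤ 2 * SequentialFooling.roundComplexity D ε) := by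
  refine ⟨⟨1281, by norm_num, ?_⟩, ?_⟩
  · intro X _ _ D hD ℓ hℓ ε hε
    obtain ⟨N, hN, hle⟩ := SequentialFooling.exists_fooledWithin hD hℓ hε
    have hT := SequentialFooling.roundComplexity_le hN
    obtain ⟨T, hTeq⟩ := ENat.ne_top_iff_exists.1 (ne_top_of_le_ne_top (ENat.natCast_ne_top N) hT)
    rw [← hTeq] at hT ⊢
    have hTN : (T : ℝ) ≤ N := by exact_mod_cast hT
    refine ⟨T, rfl, fun hℓ1 hε2 => (hTN.trans hle).trans
      (SequentialFooling.one_add_mul_log_le_mul_log hℓ1 hε hε2), (hTN.trans hle).trans ?_⟩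
    have hz : 0 ≤ (ℓ : ℝ) / ε := by positivity
    have := Real.log_nonneg (show 1 ≤ 2 + (ℓ : ℝ) / ε by linarith)
    gcongr
    norm_num
  · intro X _ _ D hD ε hε hε2
    -- The bound holds without the factor 2, which is given away here.
    refine (SequentialFooling.dualLittlestoneDim_le_roundComplexity hD hε hε2).trans ?_
    rw [two_mul]
    exact le_self_add
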